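/- Let $q$ be a power of an odd prime, $n=q+1$, and let $\alpha\in\mathbb F_q^*$ be an element of order $r\ge 2$ such that $q-1=rk$ with $k$ odd. Then for every integer $i$ with $2\le i\le n/2-2$ there exists an MDS convolutional code over $\mathbb F_q$ with parameters $(n,\,n-2i,\,2;\,1,\,2i+3)_q$. Moreover it can be obtained from an MDS $\alpha$-constacyclic code: there are an $\alpha$-constacyclic code $B\subseteq\mathbb F_q^n$ with parameters $[n,\,n-2i-2,\,2i+3]_q$ and a parity check matrix $\begin{bmatrix}H_0\\H_1\end{bmatrix}$ of $B$, with $H_0$ of size $2i\times n$ and $H_1$ of size $2\times n$, such that $V^{\perp}=\{w\in\mathbb F_q[D]^n : v\cdot w=0 \text{ for all } v\in V\}$ is such a convolutional code, where $V$ is the $\mathbb F_q[D]$-submodule of $\mathbb F_q[D]^n$ generated by the rows of $G(D)=H_0+\tilde H_1 D$, and $\tilde H_1$ is $H_1$ with zero rows added at the bottom to have $2i$ rows. Here an $\alpha$-constacyclic code of length $n$ is a linear code corresponding to a principal ideal of $\mathbb F_q[x]/(x^n-\alpha)$ under $(c_0,\dots,c_{n-1})\mapsto c_0+c_1x+\dots+c_{n-1}x^{n-1}$;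 an $[n,K,d]_q$ code has dimension $K$ and minimum distance $d$, and is MDS if $d=n-K+1$. A convolutional code with parameters $(n,K,\gamma;m,d_f)_q$ is a submodule $\{u(D)G(D) : u(D)\in\mathbb F_q[D]^K\}$ of $\mathbb F_q[D]^n$, where $G(D)\in\mathbb F_q[D]^{K\times n}$ is reduced basic (it has a polynomial right inverse, and the sum $\sum_a\gamma_a$ of its row degrees $\gamma_a=\max_j\deg g_{aj}$ is smallest among all generator matrices of the code that have a polynomial right inverse), with $\gamma=\sum_a\gamma_a$, $m=\max_a\gamma_a$, and $d_f$ the minimum weight of a nonzero codeword, the weight being the total number of nonzero coefficients of its entries. It is MDS if it attains the generalized Singleton bound, $d_f=(n-K)(\lfloor\gamma/K\rfloor+1)+\gamma+1$. -/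

import Mathlib

open scoped Polynomial

namespace CodingTheory

section Block

variable {F : Type*} [Field F]

/-- The linear block code `B ⊆ F ^ n` has dimension `k` and minimum distance `d`
(the least Hamming weight of a nonzero codeword): parameters `[n, k, d]`. -/
def HasBlockParameters [DecidableEq F] {n : ℕ} (B : Submodule F (Fin n → F)) (k d : ℕ) : Prop :=
  Module.finrank F B = k ∧
    IsLeast {w : ℕ | ∃ c ∈ B, c ≠ 0 ∧ hammingNorm c = w} d

/-- `B` is an `[n, k, d]` code that attains the Singleton bound `d ≤ n - k + 1`. -/
def IsMDSBlockCode [DecidableEq F] {n : ℕ} (B : Submodule F (Fin n → F)) (k d : ℕ) : Prop :=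
  HasBlockParameters B k d ∧ d = n - k + 1

/-- The class of `c₀ + c₁ x + ⋯ + cₙ₋₁ xⁿ⁻¹` in `F[x] / (xⁿ - α)`. -/
noncomputable def wordClass {n : ℕ} (α : F) (c : Fin n → F) :
    F[X] ⧸ Ideal.span {(Polynomial.X ^ n - Polynomial.C α : F[X])} :=
  Ideal.Quotient.mk _ (∑ j : Fin n, Polynomial.C (c j) * Polynomial.X ^ (j : ℕ))

/-- `B` is `α`-constacyclic: it corresponds to a principal ideal of `F[x] / (xⁿ - α)`. -/
def IsConstacyclic {n : ℕ} (α : F) (B : Submodule F (Fin n → F)) : Prop :=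
  ∃ I : Ideal (F[X] ⧸ Ideal.span {(Polynomial.X ^ n - Polynomial.C α : F[X])}),
    I.IsPrincipal ∧ ∀ c : Fin n → F, c ∈ B ↔ wordClass α c ∈ I

/-- `H` is a parity check matrix of `B`: the rows of `H` are linearly independent and `B` is the
set of words `c` with `H cᵀ = 0`. -/
def IsParityCheckMatrix {ι : Type*} {n : ℕ} (H : Matrix ι (Fin n) F)
    (B : Submodule F (Fin n → F)) : Prop :=
  LinearIndependent F H.row ∧ ∀ c : Fin n → F, c ∈ B ↔ H.mulVec c = 0

end Block

section Convolutional

variable {F : Type*} [Field F]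

/-- The submodule of `F[D] ^ n` generated by the rows of `G`, that is `{u G | u ∈ F[D] ^ k}`. -/
noncomputable def codeGeneratedBy {k n : ℕ} (G : Matrix (Fin k) (Fin n) F[X]) :
    Submodule F[X] (Fin n → F[X]) :=
  LinearMap.range G.vecMulLinear

/-- A polynomial matrix is basic if it has a polynomial right inverse. -/
def IsBasic {k n : ℕ} (G : Matrix (Fin k) (Fin n) F[X]) : Prop :=
  ∃ R : Matrix (Fin n) (Fin k) F[X], G * R = 1

/-- `γ_a`, the maximal degree of an entry in row `a`. -/
noncomputable def rowDegree {k n : ℕ} (G : Matrix (Fin k) (Fin n) F[X]) (a : Fin k) : ℕ :=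
  Finset.univ.sup fun j => (G a j).natDegree

/-- The overall constraint length `∑ γ_a`. -/
noncomputable def overallConstraintLength {k n : ℕ} (G : Matrix (Fin k) (Fin n) F[X]) : ℕ :=
  ∑ a, rowDegree G a

/-- The maximum of the row degrees `γ_a`. -/
noncomputable def memory {k n : ℕ} (G : Matrix (Fin k) (Fin n) F[X]) : ℕ :=
  Finset.univ.sup fun a => rowDegree G a

/-- `G` is reduced basic: it is basic and its overall constraint length is the smallest among all
basic generator matrices of the same code. -/
def IsReducedBasic {k n : ℕ} (G : Matrix (Fin k) (Fin n) F[X]) : Prop :=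
  IsBasic G ∧
    ∀ G' : Matrix (Fin k) (Fin n) F[X], IsBasic G' → codeGeneratedBy G' = codeGeneratedBy G →
      overallConstraintLength G ≤ overallConstraintLength G'

/-- The weight of a polynomial vector: the total number of nonzero coefficients of its entries. -/
def weight {n : ℕ} (v : Fin n → F[X]) : ℕ :=
  ∑ j, (v j).support.card

/-- `V` is a convolutional code with parameters `(n, k, γ; m, d)`. -/
def HasConvolutionalParameters {n : ℕ} (V : Submodule F[X] (Fin n → F[X]))
    (k γ m d : ℕ) : Prop :=
  (∃ G : Matrix (Fin k) (Fin n) F[X], IsReducedBasic G ∧ codeGeneratedBy G = V ∧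
      overallConstraintLength G = γ ∧ memory G = m) ∧
    IsLeast {w : ℕ | ∃ v ∈ V, v ≠ 0 ∧ weight v = w} d

/-- `V` is an `(n, k, γ; m, d)` convolutional code that attains the generalized Singleton bound
`d ≤ (n - k) (⌊γ / k⌋ + 1) + γ + 1`. (A basic `k × n` matrix forces `k ≤ n`.) -/
def IsMDSConvolutionalCode {n : ℕ} (V : Submodule F[X] (Fin n → F[X]))
    (k γ m d : ℕ) : Prop :=
  HasConvolutionalParameters V k γ m d ∧ d = (n - k) * (γ / k + 1) + γ + 1

/-- The dual code: the polynomial vectors orthogonal to every codeword of `V`. -/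
noncomputable def dualCode {n : ℕ} (V : Submodule F[X] (Fin n → F[X])) : Submodule F[X] (Fin n → F[X]) where
  carrier := {w | ∀ v ∈ V, v ⬝ᵥ w = 0}
  zero_mem' := fun v _ => dotProduct_zero v
  add_mem' := fun {a b} ha hb v hv => by rw [dotProduct_add, ha v hv, hb v hv, add_zero]
  smul_mem' := fun c a ha v hv => by rw [dotProduct_smul, ha v hv, smul_zero]

/-- Add zero rows at the bottom of `H` so that it has `κ` rows in total (for `l ≤ κ`). -/
def padRows {l n : ℕ} (κ : ℕ) (H : Matrix (Fin l) (Fin n) F) : Matrix (Fin κ) (Fin n) F :=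
  Matrix.of fun a j => if h : (a : ℕ) < l then H ⟨a, h⟩ j else 0

/-- The polynomial matrix `H₀ + H̃₁ D`, where `H̃₁` is `H₁` padded with zero rows. -/
noncomputable def unitMemoryMatrix {κ l n : ℕ} (H₀ : Matrix (Fin κ) (Fin n) F)
    (H₁ : Matrix (Fin l) (Fin n) F) : Matrix (Fin κ) (Fin n) F[X] :=
  H₀.map Polynomial.C + (Polynomial.X : F[X]) • (padRows κ H₁).map Polynomial.C

end Convolutional

end CodingTheory

open CodingTheory

/-!
Let `K` be the quadratic extension of `F = 𝔽_q`. Since `k` is odd, `α` is not a square in `F`, and so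
it has an `n`-th root `β ∈ K` for which `ω = β ^ (q - 1)` is a primitive `n`-th root of unity, where
`n = q + 1` (`exists_pow_eq_and_isPrimitiveRoot`). The roots of `X ^ n - α` are the `β ω ^ j`, and the
Frobenius map sends `β ω ^ j` to `β ω ^ (1 - j)`. Hence a polynomial over `F` that vanishes at
`β ω, …, β ω ^ s` vanishes at the `2 s` consecutive roots `β ω ^ (1 - s), …, β ω ^ s`, and the BCH
bound says that the corresponding word, if nonzero, has weight at least `2 s + 1`
(`two_mul_lt_hammingNorm`).

The code `B` consists of the words whose polynomial vanishes at `β ω, …, β ω ^ (i + 1)`. The matrix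
`H₀` expresses, in coordinates of `K` over `F`, vanishing at the first `i` of these points, and `H₁`
vanishing at the last one. The BCH bound and the Singleton bound
(`exists_hammingNorm_add_finrank_le`) together force `dim B = n - 2 i - 2`, minimum distance
`2 i + 3`, and linear independence of the `2 i + 2` rows of `[H₀; H₁]`.

For the convolutional code, complete `[H₀; H₁]` to an invertible matrix `[H₀; H₁; N]` with inverse
`[E₀, E₁, T]`, and let `J` be the zero-one matrix for which `J H₁` is the padded `H̃₁`. Then
`[(E₁ - D E₀ J)ᵀ; Tᵀ]` generates the dual of the code generated by `H₀ + D J H₁`, and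
`[H₁ᵀ, Nᵀ]` is a right inverse of it. It has two rows of degree one, the others being constant. This
is least possible, because the constant rows of a basic generator matrix are linearly independent
words of `B` (`le_overallConstraintLength`). As to the free distance, the first nonzero coefficient
of a codeword lies in `ker H₀`, so has weight at least `2 i + 1`, and the last one lies in `ker H₁`,
so has weight at least `2`; if there is only one nonzero coefficient, it is a word of `B`
(`le_weight_of_mem_dualCode`). The minimum `2 i + 3` is attained by a constant codeword.
-/

namespace CodingTheory

open Polynomial Matrix

/-! ### Generator matrices of the dual code -/

section Dual

variable {F : Type*} [Field F]

/-- A matrix with linearly independent rows can be completed to an invertible square matrix; the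
inverse is given in block form `[E, T]`. -/
theorem exists_complementary_rows {m : Type*} [Fintype m] [DecidableEq m] {n s : ℕ}
    (M : Matrix m (Fin n) F) (hM : LinearIndependent F M.row) (hs : n = Fintype.card m + s) :
    ∃ (N : Matrix (Fin s) (Fin n) F) (E : Matrix (Fin n) m F) (T : Matrix (Fin n) (Fin s) F),
      M * E = 1 ∧ M * T = 0 ∧ N * E = 0 ∧ N * T = 1 ∧ E * M + T * N = 1 := by
  classical
  let b := Module.Basis.sumExtend hM
  have hfin : Finite (m ⊕ Module.Basis.sumExtendIndex hM) := Module.Finite.finite_basis b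
  have : Finite (Module.Basis.sumExtendIndex hM) := Finite.sum_right m
  have := Fintype.ofFinite (Module.Basis.sumExtendIndex hM)
  have hcard : Fintype.card (Module.Basis.sumExtendIndex hM) = s := by
    have := Module.finrank_eq_card_basis b
    simp only [Module.finrank_fintype_fun_eq_card, Fintype.card_fin, Fintype.card_sum] at this
    omega
  let c : Module.Basis (m ⊕ Fin s) F (Fin n → F) :=
    b.reindex (Equiv.sumCongr (Equiv.refl m) (Fintype.equivFinOfCardEq hcard))
  have hc (a : m) : c (Sum.inl a) = M a := by
    simp [c, b, Module.Basis.sumExtend]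
    rfl
  let N : Matrix (Fin s) (Fin n) F := Matrix.of fun t => c (Sum.inr t)
  have hP : (Pi.basisFun F (Fin n)).toMatrix c = (fromRows M N)ᵀ := by
    ext j (a | t)
    · simp [Module.Basis.toMatrix_apply, hc]
    · simp [Module.Basis.toMatrix_apply, N]
  let Q := (c.toMatrix (Pi.basisFun F (Fin n)))ᵀ
  have h₁ : fromRows M N * Q = 1 := by
    rw [← transpose_inj, transpose_mul, ← hP, transpose_one, transpose_transpose]
    exact c.toMatrix_mul_toMatrix_flip _
  have h₂ : Q * fromRows M N = 1 := by
    rw [← transpose_inj, transpose_mul, ← hP, transpose_one, transpose_transpose]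
    exact (Pi.basisFun F (Fin n)).toMatrix_mul_toMatrix_flip c
  refine ⟨N, Q.toCols₁, Q.toCols₂, ?_⟩
  rw [← fromCols_toCols Q, fromRows_mul_fromCols, ← fromBlocks_one, fromBlocks_inj] at h₁
  rw [← fromCols_toCols Q, fromCols_mul_fromRows] at h₂
  exact ⟨h₁.1, h₁.2.1, h₁.2.2.1, h₁.2.2.2, h₂⟩

theorem mem_dualCode_codeGeneratedBy_iff {κ n : ℕ} (G : Matrix (Fin κ) (Fin n) F[X])
    (w : Fin n → F[X]) : w ∈ dualCode (codeGeneratedBy G) ↔ G *ᵥ w = 0 := by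
  change (∀ v ∈ LinearMap.range G.vecMulLinear, v ⬝ᵥ w = 0) ↔ _
  simp only [LinearMap.mem_range, forall_exists_index, forall_apply_eq_imp_iff,
    vecMulLinear_apply, ← dotProduct_mulVec]
  refine ⟨fun h => dotProduct_eq_zero _ fun u => ?_, fun h u => ?_⟩
  · rw [dotProduct_comm, h u]
  · rw [h, dotProduct_zero]

/-- Padding with zero rows is multiplication by the padded identity matrix. -/
theorem padRows_eq_mul {κ l n : ℕ} (H : Matrix (Fin l) (Fin n) F) :
    padRows κ H = padRows κ (1 : Matrix (Fin l) (Fin l) F) * H := by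
  ext a j
  by_cases h : (a : ℕ) < l
  · simp [padRows, Matrix.mul_apply, h, Matrix.one_apply]
  · simp [padRows, Matrix.mul_apply, h]

theorem padRows_mulVec_eq_zero_iff {κ l n : ℕ} (hl : l ≤ κ) (H : Matrix (Fin l) (Fin n) F)
    (c : Fin n → F) : padRows κ H *ᵥ c = 0 ↔ H *ᵥ c = 0 := by
  constructor
  · intro h
    ext a
    simpa [padRows, mulVec] using congrFun h (Fin.castLE hl a)
  · intro h
    ext a
    by_cases ha : (a : ℕ) < l
    · simpa [padRows, mulVec, ha] using congrFun h ⟨a, ha⟩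
    · simp [padRows, mulVec, ha]

theorem coeff_map_C_mulVec {κ n : ℕ} (H : Matrix (Fin κ) (Fin n) F) (w : Fin n → F[X])
    (t : ℕ) (a : Fin κ) :
    ((H.map C *ᵥ w) a).coeff t = (H *ᵥ fun j => (w j).coeff t) a := by
  simp [mulVec, dotProduct]

/-- A polynomial vector with coefficient vectors `w₀, w₁, …` is orthogonal to the rows of
`H₀ + H̃₁ D` exactly when `H₀ w₀ = 0` and `H₀ wₜ₊₁ + H̃₁ wₜ = 0` for all `t`. -/
theorem unitMemoryMatrix_mulVec_eq_zero_iff {κ l n : ℕ} (H₀ : Matrix (Fin κ) (Fin n) F)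
    (H₁ : Matrix (Fin l) (Fin n) F) (w : Fin n → F[X]) :
    unitMemoryMatrix H₀ H₁ *ᵥ w = 0 ↔
      (H₀ *ᵥ fun j => (w j).coeff 0) = 0 ∧
        ∀ t, (H₀ *ᵥ fun j => (w j).coeff (t + 1)) +
          (padRows κ H₁ *ᵥ fun j => (w j).coeff t) = 0 := by
  have key (a : Fin κ) : (unitMemoryMatrix H₀ H₁ *ᵥ w) a =
      (H₀.map C *ᵥ w) a + X * ((padRows κ H₁).map C *ᵥ w) a := by
    simp [unitMemoryMatrix, add_mulVec, smul_mulVec]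
  constructor
  · intro h
    constructor
    · ext a
      have := congrArg (coeff · 0) ((key a).symm.trans (congrFun h a))
      simpa [coeff_map_C_mulVec] using this
    · intro t
      ext a
      have := congrArg (coeff · (t + 1)) ((key a).symm.trans (congrFun h a))
      simpa [coeff_map_C_mulVec, coeff_X_mul] using this
  · rintro ⟨h₀, h₁⟩
    ext a t
    rw [key]
    cases t with
    | zero => simpa [coeff_map_C_mulVec] using congrFun h₀ a
    | succ t => simpa [coeff_map_C_mulVec, coeff_X_mul] using congrFun (h₁ t) a

/-- The constant codewords of the dual code are the words of the block code with parity check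
matrix `[H₀; H₁]`. -/
theorem unitMemoryMatrix_mulVec_C_eq_zero_iff {κ l n : ℕ} (hl : l ≤ κ)
    (H₀ : Matrix (Fin κ) (Fin n) F) (H₁ : Matrix (Fin l) (Fin n) F) (c : Fin n → F) :
    (unitMemoryMatrix H₀ H₁ *ᵥ fun j => C (c j)) = 0 ↔ fromRows H₀ H₁ *ᵥ c = 0 := by
  have hsum : fromRows H₀ H₁ *ᵥ c = 0 ↔ H₀ *ᵥ c = 0 ∧ H₁ *ᵥ c = 0 := by
    rw [fromRows_mulVec]
    constructor
    · intro h
      exact ⟨funext fun a => congrFun h (Sum.inl a), funext fun a => congrFun h (Sum.inr a)⟩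
    · rintro ⟨h₀, h₁⟩
      rw [h₀, h₁]
      ext (a | a) <;> rfl
  rw [unitMemoryMatrix_mulVec_eq_zero_iff, hsum]
  refine and_congr (by simp) ?_
  constructor
  · intro h
    have := h 0
    simp only [coeff_C_succ, coeff_C_zero] at this
    rw [show (fun _ : Fin n => (0 : F)) = 0 from rfl, mulVec_zero, zero_add] at this
    exact (padRows_mulVec_eq_zero_iff hl H₁ c).1 this
  · intro h t
    simp only [coeff_C_succ]
    rw [show (fun _ : Fin n => (0 : F)) = 0 from rfl, mulVec_zero, zero_add]
    cases t with
    | zero => simpa using (padRows_mulVec_eq_zero_iff hl H₁ c).2 h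
    | succ t =>
      simp only [coeff_C_succ]
      exact mulVec_zero _

/-- A basic generator matrix of the dual code has overall constraint length at least `l`, the number
of rows of `H₁`: its constant rows are linearly independent words of the block code with parity
check matrix `[H₀; H₁]`, so there are at most `n - κ - l` of them. -/
theorem le_overallConstraintLength {κ l k n : ℕ} (hl : l ≤ κ)
    (H₀ : Matrix (Fin κ) (Fin n) F) (H₁ : Matrix (Fin l) (Fin n) F)
    (hH : LinearIndependent F (fromRows H₀ H₁).row) (hn : n ≤ κ + k)
    (G : Matrix (Fin k) (Fin n) F[X]) (hG : IsBasic G)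
    (hV : ∀ a, G a ∈ dualCode (codeGeneratedBy (unitMemoryMatrix H₀ H₁))) :
    l ≤ overallConstraintLength G := by
  classical
  set M := fromRows H₀ H₁
  -- `Z` indexes the constant rows, `v` lists them as vectors over `F`.
  let Z : Finset (Fin k) := Finset.univ.filter fun a => rowDegree G a = 0
  let v : Z → Fin n → F := fun a j => (G a j).coeff 0
  have hGv (a : Z) (j : Fin n) : G a j = C (v a j) := by
    refine eq_C_of_natDegree_eq_zero (Nat.le_zero.1 ?_)
    rw [← (Finset.mem_filter.1 a.2).2]
    exact Finset.le_sup (f := fun j => (G a j).natDegree) (Finset.mem_univ j)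
  have hvM (a : Z) : v a ∈ LinearMap.ker M.mulVecLin := by
    have := (mem_dualCode_codeGeneratedBy_iff _ _).1 (hV a)
    rw [funext (hGv a)] at this
    exact (unitMemoryMatrix_mulVec_C_eq_zero_iff hl H₀ H₁ _).1 this
  have hGli : LinearIndependent F[X] G.row := by
    obtain ⟨R, hR⟩ := hG
    rw [← vecMul_injective_iff]
    intro x y hxy
    have := congrArg (· ᵥ* R) hxy
    simpa [vecMul_vecMul, hR] using this
  have hvli : LinearIndependent F v := by
    rw [Fintype.linearIndependent_iff]
    intro g hg a
    have hli := Fintype.linearIndependent_iff.1 (hGli.comp (Subtype.val : Z → Fin k)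
      Subtype.val_injective) (fun a => C (g a)) ?_ a
    · simpa using hli
    · ext1 j
      have := congrArg C (congrFun hg j)
      simpa [Finset.sum_apply, hGv] using this
  have hker : Module.finrank F (LinearMap.ker M.mulVecLin) + (κ + l) = n := by
    have h := M.mulVecLin.finrank_range_add_finrank_ker
    have hr : M.rank = κ + l := by simpa using hH.rank_matrix
    rw [Matrix.rank] at hr
    simp only [Module.finrank_fintype_fun_eq_card, Fintype.card_fin] at h
    omega
  have hZ : Z.card ≤ Module.finrank F (LinearMap.ker M.mulVecLin) := by
    have : LinearIndependent F fun a : Z => (⟨v a, hvM a⟩ : LinearMap.ker M.mulVecLin) :=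
      LinearIndependent.of_comp (LinearMap.ker M.mulVecLin).subtype hvli
    simpa using this.fintype_card_le_finrank
  have hsum : (Finset.univ.filter fun a => ¬ rowDegree G a = 0).card ≤
      overallConstraintLength G := by
    rw [Finset.card_eq_sum_ones, overallConstraintLength]
    refine le_trans (Finset.sum_le_sum fun a ha => ?_)
      (Finset.sum_le_sum_of_subset (Finset.subset_univ _))
    exact Nat.one_le_iff_ne_zero.2 (Finset.mem_filter.1 ha).2
  have hcard := Finset.card_filter_add_card_filter_not
    (s := (Finset.univ : Finset (Fin k))) (fun a => rowDegree G a = 0)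
  simp only [Finset.card_univ, Fintype.card_fin] at hcard
  change Z.card + _ = k at hcard
  omega

/-- Over a commutative ring, let `[H₀; H₁; N]` be invertible with inverse `[E₀, E₁, T]`. Then the
kernel of `H₀ + x J H₁` is the row space of `[(E₁ - x E₀ J)ᵀ; Tᵀ]`. -/
theorem mulVec_eq_zero_iff_exists_vecMul {R κ l s n : Type*} [CommRing R]
    [Fintype κ] [Fintype l] [Fintype s] [Fintype n]
    [DecidableEq κ] [DecidableEq l] [DecidableEq n]
    {H₀ : Matrix κ n R} {H₁ : Matrix l n R} {N : Matrix s n R} {E₀ : Matrix n κ R}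
    {E₁ : Matrix n l R} {T : Matrix n s R} (h₀₀ : H₀ * E₀ = 1) (h₀₁ : H₀ * E₁ = 0)
    (h₁₀ : H₁ * E₀ = 0) (h₁₁ : H₁ * E₁ = 1) (h₀T : H₀ * T = 0) (h₁T : H₁ * T = 0)
    (hsum : E₀ * H₀ + E₁ * H₁ + T * N = 1) (x : R) (J : Matrix κ l R) (w : n → R) :
    (H₀ + x • (J * H₁)) *ᵥ w = 0 ↔
      ∃ u : l ⊕ s → R, u ᵥ* fromRows (E₁ - x • (E₀ * J))ᵀ Tᵀ = w := by
  constructor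
  · intro h
    -- Expand `w = (E₀ H₀ + E₁ H₁ + T N) w` and substitute `H₀ w = -x J H₁ w`.
    refine ⟨Sum.elim (H₁ *ᵥ w) (N *ᵥ w), ?_⟩
    have hw : H₀ *ᵥ w = -((x • (J * H₁)) *ᵥ w) := by
      rwa [add_mulVec, add_eq_zero_iff_eq_neg] at h
    have h1 : (E₀ * H₀ + E₁ * H₁ + T * N) *ᵥ w = w := by rw [hsum, one_mulVec]
    rw [add_mulVec, add_mulVec, ← mulVec_mulVec, hw] at h1
    rw [sumElim_vecMul_fromRows, vecMul_transpose, vecMul_transpose, mulVec_mulVec, mulVec_mulVec,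
      Matrix.sub_mul, sub_mulVec]
    refine Eq.trans ?_ h1
    simp only [mulVec_neg, mulVec_mulVec, Matrix.smul_mul, Matrix.mul_smul, Matrix.mul_assoc]
    abel
  · rintro ⟨u, rfl⟩
    rw [← mulVec_transpose, mulVec_mulVec, transpose_fromRows, transpose_transpose,
      transpose_transpose, mul_fromCols]
    have hT : (H₀ + x • (J * H₁)) * T = 0 := by
      rw [Matrix.add_mul, h₀T, Matrix.smul_mul, Matrix.mul_assoc, h₁T]; simp
    have hE : (H₀ + x • (J * H₁)) * (E₁ - x • (E₀ * J)) = 0 := by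
      rw [Matrix.add_mul, Matrix.mul_sub, Matrix.mul_sub, h₀₁, Matrix.mul_smul,
        ← Matrix.mul_assoc, h₀₀, Matrix.smul_mul, Matrix.smul_mul,
        Matrix.mul_smul, Matrix.mul_assoc, h₁₁, Matrix.mul_assoc, ← Matrix.mul_assoc H₁, h₁₀]
      simp
    rw [hT, hE]
    ext a
    simp

/-- If the rows of `H₀` and `H₁` are linearly independent, the dual of the code generated by
`H₀ + H̃₁ D` has a reduced basic generator matrix with `l` rows of degree one, `l` being the number
of rows of `H₁`, and all other rows constant. -/
theorem exists_isReducedBasic_dualCode {κ l k n : ℕ} (hl : l ≤ κ) (hl₀ : 0 < l)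
    (H₀ : Matrix (Fin κ) (Fin n) F) (H₁ : Matrix (Fin l) (Fin n) F)
    (hH : LinearIndependent F (fromRows H₀ H₁).row) (hn : n = κ + k) (hk : l ≤ k) :
    ∃ G : Matrix (Fin k) (Fin n) F[X], IsReducedBasic G ∧
      codeGeneratedBy G = dualCode (codeGeneratedBy (unitMemoryMatrix H₀ H₁)) ∧
      overallConstraintLength G = l ∧ memory G = 1 := by
  classical
  obtain ⟨s, rfl⟩ := Nat.exists_eq_add_of_le hk
  obtain ⟨N, E, T, hME, hMT, hNE, hNT, hsum⟩ :=
    exists_complementary_rows (fromRows H₀ H₁) hH (s := s) (by simp; omega)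
  obtain ⟨E₀, E₁, rfl⟩ : ∃ E₀ E₁, E = fromCols E₀ E₁ := ⟨_, _, (fromCols_toCols E).symm⟩
  rw [fromRows_mul_fromCols, ← fromBlocks_one, fromBlocks_inj] at hME
  obtain ⟨h₀₀, h₀₁, h₁₀, h₁₁⟩ := hME
  rw [fromRows_mul, ← fromRows_zero, fromRows_ext_iff] at hMT
  rw [mul_fromCols, ← fromCols_zero, fromCols_ext_iff] at hNE
  rw [fromCols_mul_fromRows] at hsum
  set J : Matrix (Fin κ) (Fin l) F := padRows κ (1 : Matrix (Fin l) (Fin l) F)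
  -- Everything is transported to `F[X]` along `C`.
  let A : Matrix (Fin l ⊕ Fin s) (Fin n) F[X] :=
    fromRows (E₁.map C - (X : F[X]) • (E₀.map C * J.map C))ᵀ (T.map C)ᵀ
  let e : Fin (l + s) ≃ Fin l ⊕ Fin s := finSumFinEquiv.symm
  have hmul {a b c : Type} [Fintype b] (P : Matrix a b F) (Q : Matrix b c F) :
    P.map C * Q.map C = (P * Q).map C := (Matrix.map_mul (f := (C : F →+* F[X]))).symm
  have hone {a : Type} [DecidableEq a] : (1 : Matrix a a F).map C = 1 :=
    Matrix.map_one _ C_0 C_1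
  have hzero {a b : Type} : (0 : Matrix a b F).map C = 0 := Matrix.map_zero _ C_0
  have hmem (w : Fin n → F[X]) : unitMemoryMatrix H₀ H₁ *ᵥ w = 0 ↔ ∃ u, u ᵥ* A = w := by
    have hG : unitMemoryMatrix H₀ H₁ = H₀.map C + (X : F[X]) • (J.map C * H₁.map C) := by
      rw [hmul, unitMemoryMatrix, padRows_eq_mul]
    rw [hG]
    refine mulVec_eq_zero_iff_exists_vecMul (N := N.map C) ?_ ?_ ?_ ?_ ?_ ?_ ?_ _ _ w
    · rw [hmul, h₀₀, hone]
    · rw [hmul, h₀₁, hzero]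
    · rw [hmul, h₁₀, hzero]
    · rw [hmul, h₁₁, hone]
    · rw [hmul, hMT.1, hzero]
    · rw [hmul, hMT.2, hzero]
    · rw [hmul, hmul, hmul, ← hone, ← hsum]
      refine Matrix.ext fun a b => ?_
      simp only [Matrix.add_apply, Matrix.map_apply, C_add]
  have hcode : codeGeneratedBy (A.submatrix e id) =
      dualCode (codeGeneratedBy (unitMemoryMatrix H₀ H₁)) := by
    ext w
    rw [mem_dualCode_codeGeneratedBy_iff, hmem]
    change (∃ u, u ᵥ* A.submatrix e id = w) ↔ _
    constructor
    · rintro ⟨u, rfl⟩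
      exact ⟨u ∘ e.symm, by rw [submatrix_vecMul_equiv]; simp⟩
    · rintro ⟨u, rfl⟩
      exact ⟨u ∘ e, by rw [submatrix_vecMul_equiv]; ext; simp [Function.comp_assoc]⟩
  have hbasic : IsBasic (A.submatrix e id) := by
    refine ⟨(fromCols (H₁.map C)ᵀ (N.map C)ᵀ).submatrix id e, ?_⟩
    rw [← submatrix_mul _ _ e id e Function.bijective_id]
    have : A * fromCols (H₁.map C)ᵀ (N.map C)ᵀ = 1 := by
      simp only [A]
      rw [fromRows_mul_fromCols, ← fromBlocks_one, fromBlocks_inj]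
      simp only [← transpose_mul, Matrix.mul_sub, Matrix.mul_smul, ← Matrix.mul_assoc]
      simp only [hmul, h₁₁, h₁₀, hNE.1, hNE.2, hMT.2, hNT, hone, hzero]
      simp
    rw [this, submatrix_one_equiv]
  have hdeg (a : Fin (l + s)) : rowDegree (A.submatrix e id) a =
      Sum.elim (fun _ => 1) (fun _ => 0) (e a) := by
    rcases h : e a with b | t
    · have hent (j : Fin n) : A.submatrix e id a j = C (E₁ j b) - X * C ((E₀ * J) j b) := by
        simp [A, h, -Matrix.map_mul, hmul]
      refine le_antisymm (Finset.sup_le fun j _ => ?_) ?_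
      · rw [hent]
        refine (natDegree_sub_le _ _).trans ?_
        simp only [natDegree_C, Sum.elim_inl, zero_le, sup_of_le_right]
        rw [X_mul_C]
        exact (natDegree_C_mul_le _ _).trans natDegree_X_le
      · -- `H₀ E₀ J = J` has no zero column, so neither does `E₀ J`.
        obtain ⟨j, hj⟩ : ∃ j, (E₀ * J) j b ≠ 0 := by
          by_contra! hall
          have : (H₀ * (E₀ * J)) (Fin.castLE hl b) b = 0 := by
            rw [Matrix.mul_apply]
            exact Finset.sum_eq_zero fun j _ => by rw [hall, mul_zero]
          rw [← Matrix.mul_assoc, h₀₀, Matrix.one_mul] at this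
          simp [J, padRows, Matrix.one_apply] at this
        refine le_trans ?_ (Finset.le_sup (Finset.mem_univ j))
        rw [hent]
        refine le_natDegree_of_ne_zero ?_
        simpa [coeff_C] using hj
    · refine Nat.le_zero.1 (Finset.sup_le fun j _ => ?_)
      simp [A, h]
  have hlen : overallConstraintLength (A.submatrix e id) = l := by
    simp only [overallConstraintLength, hdeg]
    rw [Equiv.sum_comp e (Sum.elim (fun _ => 1) (fun _ => 0))]
    simp
  refine ⟨A.submatrix e id, ⟨hbasic, fun G' hG' hc => ?_⟩, hcode, hlen, ?_⟩
  · rw [hlen]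
    refine le_overallConstraintLength hl H₀ H₁ hH hn.le G' hG' fun a => ?_
    rw [← hcode, ← hc]
    exact ⟨Pi.single a 1, single_one_vecMul a G'⟩
  · refine le_antisymm (Finset.sup_le fun a _ => ?_) ?_
    · rw [hdeg]
      rcases e a with b | t <;> simp
    · refine le_trans ?_ (Finset.le_sup (Finset.mem_univ (e.symm (Sum.inl ⟨0, hl₀⟩))))
      simp [hdeg]

end Dual

/-! ### Free distance of the dual code -/

section FreeDistance

variable {F : Type*} [Field F] [DecidableEq F]

theorem hammingNorm_coeff_le_weight {n : ℕ} (w : Fin n → F[X]) (t : ℕ) :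
    hammingNorm (fun j => (w j).coeff t) ≤ weight w := by
  rw [hammingNorm, Finset.card_filter, weight]
  refine Finset.sum_le_sum fun j _ => ?_
  split_ifs with h
  · exact Finset.card_pos.2 ⟨t, mem_support_iff.2 h⟩
  · exact Nat.zero_le _

theorem hammingNorm_coeff_add_le_weight {n : ℕ} (w : Fin n → F[X]) {t t' : ℕ}
    (htt : t ≠ t') : hammingNorm (fun j => (w j).coeff t) + hammingNorm (fun j => (w j).coeff t') ≤
      weight w := by
  rw [hammingNorm, hammingNorm, Finset.card_filter, Finset.card_filter, weight,
    ← Finset.sum_add_distrib]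
  refine Finset.sum_le_sum fun j _ => ?_
  have : ((w j).support.filter (· = t)).card + ((w j).support.filter (· = t')).card ≤
      (w j).support.card := by
    rw [← Finset.card_union_of_disjoint]
    · exact Finset.card_le_card (by grind)
    · exact Finset.disjoint_left.2 (by grind)
  simpa [Finset.filter_eq', apply_ite Finset.card] using this

theorem weight_C {n : ℕ} (c : Fin n → F) :
    weight (fun j => C (c j)) = hammingNorm c := by
  rw [hammingNorm, Finset.card_filter, weight]
  refine Finset.sum_congr rfl fun j _ => ?_
  split_ifs with h
  · simp [support_C h]
  · simp [not_not.1 h]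

/-- The first nonzero coefficient of a word of the dual code lies in `ker H₀` and the last one in
`ker H₁`; if they coincide, it lies in both. -/
theorem le_weight_of_mem_dualCode {κ l n d d₀ d₁ : ℕ} (hl : l ≤ κ)
    (H₀ : Matrix (Fin κ) (Fin n) F) (H₁ : Matrix (Fin l) (Fin n) F)
    (h₀ : ∀ c, H₀ *ᵥ c = 0 → c ≠ 0 → d₀ ≤ hammingNorm c)
    (h₁ : ∀ c, H₁ *ᵥ c = 0 → c ≠ 0 → d₁ ≤ hammingNorm c)
    (h : ∀ c, H₀ *ᵥ c = 0 → H₁ *ᵥ c = 0 → c ≠ 0 → d ≤ hammingNorm c) (hd : d ≤ d₀ + d₁)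
    {w : Fin n → F[X]} (hw : w ∈ dualCode (codeGeneratedBy (unitMemoryMatrix H₀ H₁)))
    (hw₀ : w ≠ 0) : d ≤ weight w := by
  classical
  rw [mem_dualCode_codeGeneratedBy_iff, unitMemoryMatrix_mulVec_eq_zero_iff] at hw
  let W : ℕ → Fin n → F := fun t j => (w j).coeff t
  obtain ⟨hW₀, hW⟩ : H₀ *ᵥ W 0 = 0 ∧ ∀ t, H₀ *ᵥ W (t + 1) + padRows κ H₁ *ᵥ W t = 0 := hw
  let S : Finset ℕ := Finset.univ.biUnion fun j => (w j).support
  have hS (t : ℕ) : t ∈ S ↔ W t ≠ 0 := by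
    simp [S, W, funext_iff]
  have hne : S.Nonempty := by
    obtain ⟨j, hj⟩ := Function.ne_iff.1 hw₀
    obtain ⟨t, ht⟩ := nonempty_support_iff.2 hj
    exact ⟨t, Finset.mem_biUnion.2 ⟨j, Finset.mem_univ j, ht⟩⟩
  have hmin : H₀ *ᵥ W (S.min' hne) = 0 := by
    rcases ht : S.min' hne with _ | t
    · exact hW₀
    · have : W t = 0 := by
        by_contra hc
        have := S.min'_le t ((hS t).2 hc)
        omega
      simpa [this] using hW t
  have hmax : H₁ *ᵥ W (S.max' hne) = 0 := by
    have : W (S.max' hne + 1) = 0 := by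
      by_contra hc
      have := S.le_max' _ ((hS _).2 hc)
      omega
    rw [← padRows_mulVec_eq_zero_iff hl]
    simpa [this] using hW (S.max' hne)
  have hmin' := (hS _).1 (S.min'_mem hne)
  have hmax' := (hS _).1 (S.max'_mem hne)
  by_cases heq : S.min' hne = S.max' hne
  · rw [← heq] at hmax
    exact (h _ hmin hmax hmin').trans (hammingNorm_coeff_le_weight w _)
  · exact hd.trans ((Nat.add_le_add (h₀ _ hmin hmin') (h₁ _ hmax hmax')).trans
      (hammingNorm_coeff_add_le_weight w heq))

end FreeDistance

/-! ### The Singleton bound -/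

section Singleton

variable {F : Type*} [Field F] [DecidableEq F]

/-- The Singleton bound, in the form: a nonzero code has a nonzero word of weight at most
`n - k + 1`, found by prescribing zeros in `k - 1` coordinates. -/
theorem exists_hammingNorm_add_finrank_le {n : ℕ} (B : Submodule F (Fin n → F))
    (hB : 0 < Module.finrank F B) :
    ∃ c ∈ B, c ≠ 0 ∧ hammingNorm c + Module.finrank F B ≤ n + 1 := by
  obtain ⟨m, hm⟩ := Nat.exists_eq_succ_of_ne_zero hB.ne'
  have hBn : Module.finrank F B ≤ n := by simpa using B.finrank_le
  have hmn : m ≤ n := by omega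
  let f : B →ₗ[F] (Fin m → F) := LinearMap.funLeft F F (Fin.castLE hmn) ∘ₗ B.subtype
  have hker : LinearMap.ker f ≠ ⊥ := by
    refine LinearMap.ker_ne_bot_of_finrank_lt ?_
    rw [hm, Module.finrank_fintype_fun_eq_card, Fintype.card_fin]
    exact Nat.lt_succ_self m
  obtain ⟨c, hc, hc₀⟩ := Submodule.exists_mem_ne_zero_of_ne_bot hker
  refine ⟨c, c.2, by simpa using hc₀, ?_⟩
  have hz (a : Fin m) : (c : Fin n → F) (Fin.castLE hmn a) = 0 := congrFun hc a
  have hdisj : Disjoint (Finset.univ.filter fun j => (c : Fin n → F) j ≠ 0)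
      (Finset.univ.map (Fin.castLEEmb hmn)) := by
    rw [Finset.disjoint_right]
    intro j hj
    obtain ⟨a, -, rfl⟩ := Finset.mem_map.1 hj
    simp [hz]
  have := Finset.card_le_univ (Finset.disjUnion _ _ hdisj)
  simp only [Finset.card_disjUnion, Finset.card_map, Finset.card_univ, Fintype.card_fin] at this
  rw [hammingNorm]
  omega

end Singleton

/-! ### Evaluation of words and the BCH bound -/

section Evaluation

/-- If `∑ d_l x_l ^ t` vanishes for all `t < m`, the `x_l` being distinct, then so does
`∑ d_l P(x_l)` for every polynomial `P` of degree less than `m`; if at most `m` of the `d_l` are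
nonzero, `P` can be chosen to vanish at all but one of the corresponding `x_l`. -/
theorem eq_zero_of_forall_sum_mul_pow_eq_zero {ι R : Type*} [Fintype ι] [CommRing R] [IsDomain R]
    [DecidableEq R] {x d : ι → R} (hx : Function.Injective x) {m : ℕ} (hd : hammingNorm d ≤ m)
    (h : ∀ t < m, ∑ l, d l * x l ^ t = 0) : d = 0 := by
  classical
  by_contra hne
  obtain ⟨a, ha⟩ := Function.ne_iff.1 hne
  let S : Finset ι := (Finset.univ.filter fun l => d l ≠ 0).erase a
  have haS : S.card + 1 ≤ m := by
    rw [Finset.card_erase_add_one (by simpa using ha)]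
    exact hd
  let P : R[X] := ∏ l ∈ S, (X - C (x l))
  have hP : P.natDegree < m := by
    rw [natDegree_prod_of_monic _ _ fun l _ => monic_X_sub_C (x l)]
    simpa using haS
  have h₁ : ∑ l, d l * P.eval (x l) = 0 := by
    simp_rw [eval_eq_sum_range' hP, Finset.mul_sum]
    rw [Finset.sum_comm]
    refine Finset.sum_eq_zero fun t ht => ?_
    rw [← mul_zero (P.coeff t), ← h t (Finset.mem_range.1 ht), Finset.mul_sum]
    exact Finset.sum_congr rfl fun l _ => by ring
  rw [Finset.sum_eq_single a] at h₁
  · rcases mul_eq_zero.1 h₁ with h₂ | h₂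
    · exact ha h₂
    · rw [eval_prod, Finset.prod_eq_zero_iff] at h₂
      obtain ⟨l, hl, hl₀⟩ := h₂
      rw [eval_sub, eval_X, eval_C, sub_eq_zero] at hl₀
      exact Finset.ne_of_mem_erase hl (hx hl₀).symm
  · intro l _ hla
    by_cases hl : d l = 0
    · rw [hl, zero_mul]
    · rw [eval_prod, Finset.prod_eq_zero (i := l) (by simp [S, hl, hla]) (by simp), mul_zero]
  · simp

variable {F K : Type*} [Field F] [Field K] [Algebra F K]

/-- Evaluation of the polynomial `c₀ + c₁ X + ⋯ + cₙ₋₁ Xⁿ⁻¹` of a word `c` at a point `x` of an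
extension field. -/
noncomputable def evalWord (n : ℕ) (x : K) : (Fin n → F) →ₗ[F] K :=
  Fintype.linearCombination F fun l : Fin n => x ^ (l : ℕ)

theorem evalWord_apply {n : ℕ} (x : K) (c : Fin n → F) :
    evalWord n x c = ∑ l, algebraMap F K (c l) * x ^ (l : ℕ) := by
  simp [evalWord, Fintype.linearCombination_apply, Algebra.smul_def]

theorem aeval_sum_C_mul_X_pow {n : ℕ} (x : K) (c : Fin n → F) :
    aeval x (∑ l : Fin n, C (c l) * X ^ (l : ℕ)) = evalWord n x c := by
  simp [evalWord_apply]

theorem evalWord_pow_card [Fintype F] {n : ℕ} (x : K) (c : Fin n → F) :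
    evalWord n (x ^ Fintype.card F) c = evalWord n x c ^ Fintype.card F := by
  rw [← aeval_sum_C_mul_X_pow, ← aeval_sum_C_mul_X_pow]
  exact aeval_algHom_apply (FiniteField.frobeniusAlgHom F K) x _

/-- The BCH bound: a nonzero word whose polynomial vanishes at `b, b ω, …, b ω ^ (m - 1)`, where
`ω` is a primitive `n`-th root of unity, has weight greater than `m`. -/
theorem lt_hammingNorm_of_forall_evalWord_eq_zero [DecidableEq F] {n : ℕ} {b ω : K} (hb : b ≠ 0)
    (hω : IsPrimitiveRoot ω n) {m : ℕ} {c : Fin n → F} (hc : c ≠ 0)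
    (h : ∀ t < m, evalWord n (b * ω ^ t) c = 0) : m < hammingNorm c := by
  classical
  by_contra! hle
  let d : Fin n → K := fun l => algebraMap F K (c l) * b ^ (l : ℕ)
  have hd₀ (l : Fin n) : d l = 0 ↔ c l = 0 := by simp [d, hb]
  have hd : d = 0 := by
    refine eq_zero_of_forall_sum_mul_pow_eq_zero (x := fun l : Fin n => ω ^ (l : ℕ)) (m := m)
      (fun l l' hl => Fin.ext (hω.pow_inj l.2 l'.2 hl)) ?_ fun t ht => ?_
    · simpa [hammingNorm, hd₀] using hle
    · rw [← h t ht, evalWord_apply]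
      refine Finset.sum_congr rfl fun l _ => ?_
      rw [mul_pow, ← pow_mul, ← pow_mul, mul_comm (l : ℕ) t, mul_assoc]
  exact hc (funext fun l => (hd₀ l).1 (congrFun hd l))

/-- If `β ^ q = β ω`, where `q` is the order of the base field and `ω ^ (q + 1) = 1`, the conjugate
of `β ω ^ j` is `β ω ^ (1 - j)`. So a word vanishing at `β ω, …, β ω ^ s` vanishes at the `2 s`
consecutive points `β ω ^ (1 - s), …, β ω ^ s`. -/
theorem two_mul_lt_hammingNorm [Fintype F] [DecidableEq F] {n : ℕ} {β ω : K} (hβ : β ≠ 0)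
    (hω : IsPrimitiveRoot ω n) (hn : n = Fintype.card F + 1) (hβω : β ^ Fintype.card F = β * ω)
    {s : ℕ} {c : Fin n → F} (hc : c ≠ 0)
    (h : ∀ j < s, evalWord n (β * ω ^ (j + 1)) c = 0) : 2 * s < hammingNorm c := by
  have hω₀ : ω ≠ 0 := hω.ne_zero (by omega)
  have hωn : ω ^ Fintype.card F * ω = 1 := by rw [← pow_succ, ← hn, hω.pow_eq_one]
  refine lt_hammingNorm_of_forall_evalWord_eq_zero (b := β * ω * (ω ^ s)⁻¹) (ω := ω)
    (by positivity) hω hc fun t ht => ?_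
  rcases le_or_gt s t with hst | hst
  · obtain ⟨j, rfl⟩ := Nat.exists_eq_add_of_le hst
    have : β * ω * (ω ^ s)⁻¹ * ω ^ (s + j) = β * ω ^ (j + 1) := by
      rw [pow_add, pow_succ' ω j]
      field_simp
    rw [this, h j (by omega)]
  · obtain ⟨j, rfl⟩ := Nat.exists_eq_add_of_lt hst
    have : β * ω * (ω ^ (t + j + 1))⁻¹ * ω ^ t = (β * ω ^ (j + 1)) ^ Fintype.card F := by
      rw [mul_pow, hβω, ← pow_mul, mul_comm (j + 1), pow_mul, eq_inv_of_mul_eq_one_left hωn,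
        inv_pow, add_assoc, pow_add]
      field_simp
    rw [this, evalWord_pow_card, h j (by omega), zero_pow Fintype.card_ne_zero]

/-- The words vanishing at some given `n`-th roots of `α` form an `α`-constacyclic code. -/
theorem isConstacyclic_of_forall_mem_iff {n : ℕ} {α : F} {ι : Type*} {x : ι → K}
    (hx : ∀ j, x j ^ n = algebraMap F K α) {B : Submodule F (Fin n → F)}
    (hB : ∀ c, c ∈ B ↔ ∀ j, evalWord n (x j) c = 0) : IsConstacyclic α B := by
  let J : Ideal F[X] := ⨅ j, RingHom.ker (aeval (R := F) (x j))
  have hJ : Ideal.span {(X ^ n - C α : F[X])} ≤ J := by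
    rw [Ideal.span_singleton_le_iff_mem, Ideal.mem_iInf]
    intro j
    change aeval (x j) (X ^ n - C α) = 0
    simp [hx]
  have : IsPrincipalIdealRing (F[X] ⧸ Ideal.span {(X ^ n - C α : F[X])}) :=
    IsPrincipalIdealRing.of_surjective (Ideal.Quotient.mk _) Ideal.Quotient.mk_surjective
  refine ⟨J.map (Ideal.Quotient.mk _), IsPrincipalIdealRing.principal _, fun c => ?_⟩
  rw [hB, wordClass, Ideal.mem_quotient_iff_mem hJ, Ideal.mem_iInf]
  simp only [RingHom.mem_ker, aeval_sum_C_mul_X_pow]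

/-- The condition `evalWord n x c = 0` over the extension `K` amounts to one parity check over `F` for
each element of a basis of `K`. -/
theorem repr_pow_dotProduct {ι : Type*} (b : Module.Basis ι F K) (e : ι) {n : ℕ} (x : K)
    (c : Fin n → F) :
    (fun l : Fin n => b.repr (x ^ (l : ℕ)) e) ⬝ᵥ c = b.repr (evalWord n x c) e := by
  simp [evalWord, Fintype.linearCombination_apply, dotProduct, mul_comm]

end Evaluation

/-! ### Nonsquares in the quadratic extension -/

section FiniteField

variable {F : Type*} [Field F] [Fintype F]

/-- A unit whose powers form a subgroup of odd index is not a square, since the squares have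
index two. -/
theorem not_isSquare_of_odd_index {α : Fˣ} {k : ℕ} (hF : Odd (Fintype.card F))
    (hk : Fintype.card F - 1 = orderOf α * k) (hko : Odd k) : ¬ IsSquare (α : F) := by
  rintro ⟨b, hb⟩
  have hb₀ : b ≠ 0 := by
    rintro rfl
    simp at hb
  obtain ⟨m, hm⟩ := hF
  have h : α ^ m = 1 := by
    ext
    rw [Units.val_pow_eq_pow_val, hb, ← pow_two, ← pow_mul, Units.val_one]
    simpa [hm] using FiniteField.pow_card_sub_one_eq_one b hb₀
  obtain ⟨t, rfl⟩ := orderOf_dvd_of_pow_eq_one h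
  obtain ⟨u, rfl⟩ := hko
  have h₁ : orderOf α * (2 * u + 1) = orderOf α * (2 * t) := by rw [← hk, hm]; ring_nf; omega
  have := Nat.eq_of_mul_eq_mul_left (orderOf_pos α) h₁
  omega

/-- A nonsquare `α` of a finite field of odd order `q` is the norm of an element `β` of the
quadratic extension for which `β ^ (q - 1)` has order `q + 1`: if `g` generates the multiplicative
group of the extension, then the norm of `g` is a nonsquare, so `α = N(g) a ^ 2 = N(g a)` for some
`a` in the base field. -/
theorem exists_pow_eq_and_isPrimitiveRoot {K : Type*} [Field K] [Algebra F K] [Finite K]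
    (hK : Nat.card K = Fintype.card F ^ 2) (hF : Odd (Fintype.card F)) {α : F}
    (hα : ¬ IsSquare α) :
    ∃ β ω : K, β ^ (Fintype.card F + 1) = algebraMap F K α ∧ β ^ Fintype.card F = β * ω ∧
      IsPrimitiveRoot ω (Fintype.card F + 1) := by
  set q := Fintype.card F with hq
  have hq₁ : 1 < q := Fintype.one_lt_card
  have hchar : ringChar F ≠ 2 := by
    intro h
    have := FiniteField.even_card_of_char_two h
    rw [← hq] at this
    exact Nat.not_even_iff_odd.2 hF (Nat.even_iff.2 this)
  have hα₀ : α ≠ 0 := by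
    rintro rfl
    exact hα (IsSquare.zero)
  obtain ⟨g, hg⟩ := IsCyclic.exists_ofOrder_eq_natCard (α := Kˣ)
  have hcard : orderOf g = (q + 1) * (q - 1) := by
    rw [hg, Nat.card_units, hK, ← Nat.sq_sub_sq, one_pow]
  have hγ : algebraMap F K (Algebra.norm F (g : K)) = (g : K) ^ (q + 1) := by
    have hdiv : (q ^ 2 - 1) / (q - 1) = q + 1 := by
      rw [← one_pow 2, Nat.sq_sub_sq]
      exact Nat.mul_div_cancel _ (by omega)
    rw [FiniteField.algebraMap_norm_eq_pow, hK, Nat.card_eq_fintype_card, ← hq, hdiv]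
  set γ := Algebra.norm F (g : K)
  have hγ₀ : γ ≠ 0 := by
    intro h
    rw [h, map_zero] at hγ
    exact pow_ne_zero _ g.ne_zero hγ.symm
  have hγsq : ¬ IsSquare γ := by
    rw [FiniteField.isSquare_iff hchar hγ₀, ← hq]
    intro h
    have hg₁ : g ^ ((q + 1) * (q / 2)) = 1 := by
      ext
      rw [Units.val_pow_eq_pow_val, pow_mul, ← hγ, ← map_pow, h, map_one, Units.val_one]
    have hle := Nat.le_of_dvd (Nat.mul_pos (by omega) (by omega)) (orderOf_dvd_of_pow_eq_one hg₁)
    rw [hcard] at hle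
    have := Nat.le_of_mul_le_mul_left hle (by omega)
    obtain ⟨m, hm⟩ := hF
    omega
  have hsq : IsSquare (α / γ) := by
    have h (x : F) (hx : x ≠ 0) (hxs : ¬ IsSquare x) : x ^ (q / 2) = -1 :=
      (FiniteField.pow_dichotomy hchar hx).resolve_left
        fun h => hxs ((FiniteField.isSquare_iff hchar hx).2 h)
    rw [FiniteField.isSquare_iff hchar (div_ne_zero hα₀ hγ₀), div_pow, h α hα₀ hα, h γ hγ₀ hγsq]
    simp
  -- The norm of `g a` is `γ a ^ 2`, because `a ^ q = a`.
  obtain ⟨a, ha⟩ := hsq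
  have hαa : α = γ * (a * a) := by rw [← ha]; field_simp
  have haq : algebraMap F K a ^ q = algebraMap F K a := by
    rw [← map_pow, hq, FiniteField.pow_card]
  refine ⟨g * algebraMap F K a, (g : K) ^ (q - 1), ?_, ?_, ?_⟩
  · rw [mul_pow, ← hγ, pow_succ, haq, hαa, map_mul, map_mul]
  · rw [mul_pow, haq, mul_right_comm, ← pow_succ', Nat.sub_add_cancel hq₁.le]
  · have h := (IsPrimitiveRoot.orderOf g).pow (orderOf_pos g) (hcard.trans (mul_comm _ _))
    simpa using IsPrimitiveRoot.coe_units_iff.2 h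

end FiniteField

end CodingTheory

/-! ### The code of the words vanishing at consecutive roots -/

theorem mainTheorem7 {F : Type*} [Field F] [Fintype F] [DecidableEq F]
    (q n r k : ℕ) (hq : Fintype.card F = q) (hodd : Odd q) (hn : n = q + 1)
    (α : Fˣ) (hα : orderOf α = r) (hr : 2 ≤ r) (hrk : q - 1 = r * k) (hk : Odd k)
    (i : ℕ) (hi : 2 ≤ i) (hin : i ≤ n / 2 - 2) :
    ∃ B : Submodule F (Fin n → F),
      IsConstacyclic (α : F) B ∧ IsMDSBlockCode B (n - 2 * i - 2) (2 * i + 3) ∧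
      ∃ (H₀ : Matrix (Fin (2 * i)) (Fin n) F) (H₁ : Matrix (Fin 2) (Fin n) F),
        IsParityCheckMatrix (Matrix.fromRows H₀ H₁) B ∧
        IsMDSConvolutionalCode (dualCode (codeGeneratedBy (unitMemoryMatrix H₀ H₁)))
          (n - 2 * i) 2 1 (2 * i + 3) := by
  subst hq hα
  have hin' : 2 * i + 4 ≤ n := by omega
  obtain ⟨p, hp⟩ := CharP.exists F
  have : Fact p.Prime := ⟨CharP.char_is_prime F p⟩
  let K := FiniteField.Extension F p 2
  have hK : Nat.card K = Fintype.card F ^ 2 := by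
    rw [FiniteField.natCard_extension, Nat.card_eq_fintype_card]
  let b : Module.Basis (Fin 2) F K :=
    Module.finBasisOfFinrankEq F K (FiniteField.finrank_extension F p 2)
  obtain ⟨β, ω, hβα, hβω, hω⟩ :=
    exists_pow_eq_and_isPrimitiveRoot hK hodd (not_isSquare_of_odd_index hodd hrk hk)
  rw [← hn] at hβα hω
  have hω₀ : ω ≠ 0 := hω.ne_zero (by omega)
  have hβ : β ≠ 0 := by
    rintro rfl
    rw [zero_pow (by omega)] at hβα
    exact α.ne_zero ((map_eq_zero _).1 hβα.symm)
  have hbound {s : ℕ} {c : Fin n → F} (hc : c ≠ 0)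
      (h : ∀ j < s, evalWord n (β * ω ^ (j + 1)) c = 0) : 2 * s < hammingNorm c :=
    two_mul_lt_hammingNorm hβ hω hn hβω hc h
  have hone (x : K) (hx : x ≠ 0) (c : Fin n → F) (hc : c ≠ 0) (h : evalWord n x c = 0) :
      1 < hammingNorm c :=
    lt_hammingNorm_of_forall_evalWord_eq_zero hx hω hc fun t ht => by
      rw [Nat.lt_one_iff.1 ht, pow_zero, mul_one, h]
  -- The coordinates of the powers of `β ω ^ j` in a basis of `K` over `F` are the rows of `H₀`
  -- (for `1 ≤ j ≤ i`) and of `H₁` (for `j = i + 1`).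
  let H₀ : Matrix (Fin (2 * i)) (Fin n) F := Matrix.of fun a l =>
    b.repr ((β * ω ^ (((finProdFinEquiv.symm a).2 : ℕ) + 1)) ^ (l : ℕ)) (finProdFinEquiv.symm a).1
  let H₁ : Matrix (Fin 2) (Fin n) F := Matrix.of fun a l => b.repr ((β * ω ^ (i + 1)) ^ (l : ℕ)) a
  have hH₀ (c : Fin n → F) : H₀.mulVec c = 0 ↔ ∀ j < i, evalWord n (β * ω ^ (j + 1)) c = 0 := by
    have h (e : Fin 2) (j : Fin i) : H₀.mulVec c (finProdFinEquiv (e, j)) =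
        b.repr (evalWord n (β * ω ^ ((j : ℕ) + 1)) c) e := by
      rw [← repr_pow_dotProduct]
      simp only [Matrix.mulVec, H₀, Matrix.of_apply, Equiv.symm_apply_apply]
    constructor
    · intro h0 j hj
      rw [← b.repr.map_eq_zero_iff]
      ext e
      rw [← h e ⟨j, hj⟩, h0]
      rfl
    · intro h0
      ext a
      obtain ⟨⟨e, j⟩, rfl⟩ := finProdFinEquiv.surjective a
      rw [h, h0 j j.2]
      simp
  have hH₁ (c : Fin n → F) : H₁.mulVec c = 0 ↔ evalWord n (β * ω ^ (i + 1)) c = 0 := by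
    have h (e : Fin 2) : H₁.mulVec c e = b.repr (evalWord n (β * ω ^ (i + 1)) c) e :=
      repr_pow_dotProduct b e _ c
    rw [← b.repr.map_eq_zero_iff]
    exact ⟨fun h0 => Finsupp.ext fun e => by rw [← h, h0]; rfl,
      fun h0 => funext fun e => by rw [h, h0]; rfl⟩
  let M := Matrix.fromRows H₀ H₁
  have hM (c : Fin n → F) : M.mulVec c = 0 ↔ H₀.mulVec c = 0 ∧ H₁.mulVec c = 0 := by
    rw [Matrix.fromRows_mulVec, funext_iff, Sum.forall, funext_iff, funext_iff]
    rfl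
  let B : Submodule F (Fin n → F) := LinearMap.ker M.mulVecLin
  have hB (c : Fin n → F) : c ∈ B ↔ ∀ j < i + 1, evalWord n (β * ω ^ (j + 1)) c = 0 := by
    change M.mulVec c = 0 ↔ _
    rw [hM, hH₀, hH₁, Nat.forall_lt_succ_right]
  have hBd (c : Fin n → F) (hcB : c ∈ B) (hc : c ≠ 0) : 2 * i + 3 ≤ hammingNorm c :=
    hbound hc ((hB c).1 hcB)
  -- The matrix has `2 i + 2` rows, and the Singleton bound gives `dim B ≤ n - (2 i + 2)`.
  have hrank : M.rank + Module.finrank F B = n :=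
    M.mulVecLin.finrank_range_add_finrank_ker.trans (by simp)
  have hrank_le : M.rank ≤ 2 * i + 2 := by simpa using M.rank_le_card_height
  obtain ⟨c, hcB, hc, hcn⟩ := exists_hammingNorm_add_finrank_le B (by omega)
  have hcd := hBd c hcB hc
  have hdim : Module.finrank F B = n - 2 * i - 2 := by omega
  have hli : LinearIndependent F M.row := by
    rw [linearIndependent_iff_card_eq_finrank_span, Set.finrank, ← M.rank_eq_finrank_span_row]
    simp only [Fintype.card_sum, Fintype.card_fin]
    omega
  have hcw : hammingNorm c = 2 * i + 3 := by omega
  refine ⟨B, ?_, ⟨⟨hdim, ⟨c, hcB, hc, hcw⟩, ?_⟩, by omega⟩, H₀, H₁, ⟨hli, fun c => Iff.rfl⟩,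
    ⟨?_, ?_, ?_⟩, ?_⟩
  · refine isConstacyclic_of_forall_mem_iff (K := K)
      (x := fun j : Fin (i + 1) => β * ω ^ ((j : ℕ) + 1)) (fun j => ?_) fun c => ?_
    · rw [mul_pow, hβα, pow_right_comm, hω.pow_eq_one, one_pow, mul_one]
    · rw [hB]
      exact ⟨fun h j => h j j.2, fun h j hj => h ⟨j, hj⟩⟩
  · rintro _ ⟨c', hc'B, hc', rfl⟩
    exact hBd c' hc'B hc'
  · exact exists_isReducedBasic_dualCode (by omega) (by omega) H₀ H₁ hli (by omega) (by omega)
  · refine ⟨fun j => Polynomial.C (c j), ?_, ?_, by rw [weight_C, hcw]⟩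
    · rw [mem_dualCode_codeGeneratedBy_iff, unitMemoryMatrix_mulVec_C_eq_zero_iff (by omega)]
      exact hcB
    · intro h
      exact hc (funext fun j => Polynomial.C_eq_zero.1 (congrFun h j))
  · rintro _ ⟨w, hw, hw₀, rfl⟩
    refine le_weight_of_mem_dualCode (d₀ := 2 * i + 1) (d₁ := 2) (by omega) H₀ H₁
      (fun c h hc => hbound hc ((hH₀ c).1 h)) (fun c h hc => hone _ ?_ c hc ((hH₁ c).1 h))
      (fun c h₀ h₁ hc => hBd c ((hM c).2 ⟨h₀, h₁⟩) hc) (by omega) hw hw₀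
    exact mul_ne_zero hβ (pow_ne_zero _ hω₀)
  · rw [Nat.div_eq_of_lt (by omega)]
    omega
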